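/- **Setting.** There are $k\ge 2$ agents and $T$ rounds. A realization is a table of bits $\rho=(\rho_i(t))$, $1\le i\le k$, $1\le t\le T$, where $\rho_i(t)=1$ iff agent $i$ is clicked if shown in round $t$. A deterministic allocation rule $\mathcal A$ maps a bid profile $b\in(0,\infty)^k$, a realization $\rho$ and a round $t$ to an agent $\mathcal A(b;\rho;t)$, and it is online: the choice in round $t$ depends only on $b$ and on the clicks observed before $t$ (that is, on $\rho_{\mathcal A(b;\rho;s)}(s)$ for $s<t$). Round $t$ is *influential* for $\rho$ if for some $b$ and some $t'>t$, flipping the bit $\rho_j(t)$ with $j=\mathcal A(b;\rho;t)$ changes $\mathcal A(b;\rho;t')$. The rule $\mathcal A$ is *exploration-separated* if for every $\rho$ and every round $t$ influential for $\rho$, $\mathcal A(b;\rho;t)$ does not depend on $b$. An instance $\mathcal I$ of the stochastic MAB mechanism design problem consists of private values $v\in(0,\infty)^k$ (agents bid truthfully, $b=v$) and click-through rates $\mu\in[0,1]^k$; the bits $\rho_i(t)$ are independent with mean $\mu_i$. The regret of $\mathcal A$ on $\mathcal I$ is $$R_{\mathcal A}^{\mathcal I}(T)=T\max_i\mu_iv_i-\mathbb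 E_\rho\Big[\sum_{t=1}^T \mu_{\mathcal A(v;\rho;t)}\,v_{\mathcal A(v;\rho;t)}\Big].$$ Let $R_{\mathcal A}(T;v_{\max})$ be its supremum over all instances with $v_i\le v_{\max}$ for all $i$. Let $R_{\mathcal A,\delta}(T;v_{\max})$ be its supremum over those of these instances that have $\delta$-gap, i.e. for which the largest of the numbers $\mu_iv_i$ exceeds the second largest (counted with multiplicity) by exactly $\delta\max_iv_i$. (Expectations over $\mathcal A\sim\mathcal D$ of functions that need not be measurable are lower integrals.) **Theorem.** (1) There is an absolute constant $c>0$ such that for all $k\ge2$, $T\ge k$, $v_{\max}>0$ and every probability distribution $\mathcal D$ over exploration-separated deterministic allocation rules for $k$ agents and $T$ rounds, $$\mathbb E_{\mathcal A\sim\mathcal D}\big[R_{\mathcal A}(T;v_{\max})\big]\ \ge\ c\,v_{\max}k^{1/3}T^{2/3},$$ and, moreover, $\sup_{\mathcal I}\mathbb E_{\mathcal A\sim\mathcal D}\big[R_{\mathcal A}^{\mathcal I}(T)\big]\ge c\,v_{\max}k^{1/3}T^{2/3}$, where the supremum is over all instances with values at most $v_{\max}$. (2) Let $\gamma<1$, $\lambda<2(1-\gamma)$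 and $C\in\mathbb R$. There are $c>0$ and $T_1$, depending only on $\gamma,\lambda,C$, such that the following holds for all $k\ge2$, $T\ge T_1$, $v_{\max}>0$ and every distribution $\mathcal D$ as in (1). If $\sup_{\mathcal I}\mathbb E_{\mathcal A\sim\mathcal D}[R_{\mathcal A}^{\mathcal I}(T)]\le C\,v_{\max}T^\gamma$, with the supremum over all instances with values at most $v_{\max}$ (in particular, if $\mathbb E_{\mathcal A\sim\mathcal D}[R_{\mathcal A}(T;v_{\max})]\le C\,v_{\max}T^\gamma$), then for every $\delta\in(0,\tfrac14]$ $$\mathbb E_{\mathcal A\sim\mathcal D}\big[R_{\mathcal A,\delta}(T;v_{\max})\big]\ \ge\ c\,\delta\,v_{\max}T^{\lambda},$$ and, moreover, $\sup_{\mathcal I}\mathbb E_{\mathcal A\sim\mathcal D}[R_{\mathcal A}^{\mathcal I}(T)]\ge c\,\delta\,v_{\max}T^\lambda$, where the supremum is over the $\delta$-gap instances with values at most $v_{\max}$. -/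

import Mathlib

open scoped ENNReal
open MeasureTheory

/-- Vectors of `k` positive reals: values per click, or bids. -/
abbrev Profile (k : ℕ) : Type := Fin k → {x : ℝ // 0 < x}

/-- Click information for all agents and all rounds: `ρ i t` tells whether agent `i`
is clicked if she is shown in round `t`. -/
abbrev Realization (k T : ℕ) : Type := Fin k → Fin T → Bool

/-- The realization that coincides with `ρ` except that the bit of agent `i` at round `t`
is flipped. -/
def Realization.flip {k T : ℕ} (ρ : Realization k T) (i : Fin k) (t : Fin T) :
    Realization k T :=
  Function.update ρ i (Function.update (ρ i) t (!ρ i t))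

/-- A deterministic allocation rule for `k` agents and `T` rounds: it maps a bid profile, a
realization and a round to the agent shown in that round, and it is online, i.e. the choice in
round `t` depends on the bids and on the clicks observed before round `t` only. -/
structure AllocationRule (k T : ℕ) where
  alloc : Profile k → Realization k T → Fin T → Fin k
  online : ∀ (b : Profile k) (ρ ρ' : Realization k T) (t : Fin T),
    (∀ s : Fin T, s < t → ρ (alloc b ρ s) s = ρ' (alloc b ρ s) s) →
      alloc b ρ t = alloc b ρ' t

/-- Round `t` is influential for `ρ`: for some bid profile, flipping the click bit of the agent
shown in round `t` changes the allocation in some later round. -/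
def AllocationRule.Influential {k T : ℕ} (A : AllocationRule k T) (ρ : Realization k T)
    (t : Fin T) : Prop :=
  ∃ (b : Profile k) (t' : Fin T), t < t' ∧
    A.alloc b ρ t' ≠ A.alloc b (ρ.flip (A.alloc b ρ t) t) t'

/-- For every realization, the allocation in any round that is influential for that realization
does not depend on the bids. -/
def AllocationRule.ExplorationSeparated {k T : ℕ} (A : AllocationRule k T) : Prop :=
  ∀ (ρ : Realization k T) (t : Fin T), A.Influential ρ t →
    ∀ b b' : Profile k, A.alloc b ρ t = A.alloc b' ρ t

/-- The exploration-separated deterministic allocation rules. -/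
abbrev SeparatedRule (k T : ℕ) : Type :=
  {A : AllocationRule k T // A.ExplorationSeparated}

/-- The smallest σ-algebra for which the agent chosen at given bids, realization and round is a
random variable. -/
instance AllocationRule.instMeasurableSpace (k T : ℕ) : MeasurableSpace (AllocationRule k T) :=
  ⨆ (b : Profile k) (ρ : Realization k T) (t : Fin T),
    MeasurableSpace.comap (fun A : AllocationRule k T => A.alloc b ρ t) ⊤

/-- An instance of the stochastic problem with `k` agents: the private values (which are also the
bids) and the click-through rates. -/
structure StochasticInstance (k : ℕ) where
  value : Profile k
  ctr : Fin k → Set.Icc (0 : ℝ) 1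

/-- Expected payoff `μ_i v_i` of showing agent `i` once. -/
def StochasticInstance.payoff {k : ℕ} (I : StochasticInstance k) (i : Fin k) : ℝ :=
  (I.ctr i : ℝ) * (I.value i : ℝ)

/-- The expectation of `f` when all bits `ρ i t` are independent and `ρ i t` has mean `μ i`. -/
noncomputable def clickExpectation {k T : ℕ} (μ : Fin k → Set.Icc (0 : ℝ) 1)
    (f : Realization k T → ℝ) : ℝ :=
  ∑ ρ : Realization k T, (∏ i, ∏ t, if ρ i t then (μ i : ℝ) else 1 - (μ i : ℝ)) * f ρ

/-- The regret of an allocation rule on an instance. -/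
noncomputable def AllocationRule.regret {k T : ℕ} (A : AllocationRule k T)
    (I : StochasticInstance k) : ℝ :=
  (T : ℝ) * (⨆ i, I.payoff i) -
    clickExpectation I.ctr
      (fun ρ : Realization k T => ∑ t : Fin T, I.payoff (A.alloc I.value ρ t))

/-- The instances in which all private values are at most `vmax`. -/
def boundedInstances (k : ℕ) (vmax : ℝ) : Set (StochasticInstance k) :=
  {I | ∀ i, (I.value i : ℝ) ≤ vmax}

/-- The instances with `δ`-gap in which all private values are at most `vmax`: the best expected
payoff exceeds the second-best one by exactly `δ` times the largest value. -/
def gapInstances (k : ℕ) (δ vmax : ℝ) : Set (StochasticInstance k) :=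
  {I | I ∈ boundedInstances k vmax ∧
    ∃ i j : Fin k, i ≠ j ∧ (∀ l, I.payoff l ≤ I.payoff i) ∧
      (∀ l, l ≠ i → I.payoff l ≤ I.payoff j) ∧
      I.payoff i - I.payoff j = δ * ⨆ l, (I.value l : ℝ)}

/-- Worst-case regret of a deterministic rule over a class of instances. Regret is nonnegative, so
nothing is lost by taking the supremum in `[0, ∞]`. -/
noncomputable def AllocationRule.worstCaseRegret {k T : ℕ} (A : AllocationRule k T)
    (S : Set (StochasticInstance k)) : ℝ≥0∞ :=
  ⨆ I ∈ S, ENNReal.ofReal (A.regret I)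

/-- The expected worst-case regret `E_{A ∼ D} [sup_I R_A^I]`. -/
noncomputable def expectedWorstCaseRegret {k T : ℕ} (D : Measure (SeparatedRule k T))
    (S : Set (StochasticInstance k)) : ℝ≥0∞ :=
  ∫⁻ A, A.1.worstCaseRegret S ∂D

/-- The worst-case expected regret `sup_I E_{A ∼ D} [R_A^I]`, i.e. the worst-case regret of the
randomized rule `D`. -/
noncomputable def worstCaseExpectedRegret {k T : ℕ} (D : Measure (SeparatedRule k T))
    (S : Set (StochasticInstance k)) : ℝ≥0∞ :=
  ⨆ I ∈ S, ∫⁻ A, ENNReal.ofReal (A.1.regret I) ∂D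

/-!
Start from click-through rates that are all `1 / 2`. Raising the rate of agent `i` to `1 / 2 + ε`
multiplies the probability of a realization by `∏ t, (1 + 2 * ε * σ t)`, where `σ t = ± 1` is the
centred click bit of `i` in round `t`. Exploration separation makes the allocation independent of
the bits in rounds that are not bid-independently given to `i`, so the factors of these rounds
average out. The other factors form a martingale, and their product stays near `1` as long as the
expected number of rounds exploring `i` is small compared with `ε⁻²`. Summing over `i`, either the
rule loses on the order of `ε * v * T` on some instance with one raised rate, or it explores on the
order of `k * ε⁻²` times in total.

Exploration is expensive because exploring rounds are the same for all bids: on the instances that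
favour one agent by her value instead of her rate, so that there is a `δ`-gap, an exploring round
costs `δ * v` for all but one choice of the favoured agent. Averaging over that choice, the regret
on `δ`-gap instances is at least of the order of `k * δ * v * ε⁻²`. Taking `δ = 1 / 4` and `ε` of
the order of `(k / T) ^ (1 / 3)` balances the two losses and gives the first part; taking `ε` of
the order of `T ^ (γ - 1)`, so that the first loss is excluded, gives the second.
-/

/-- The centred click bit: `1` for a click, `-1` for no click, so that its mean at click-through
rate `1 / 2` is zero. -/
def clickSign (x : Bool) : ℝ := if x then 1 else -1

lemma clickSign_not (x : Bool) : clickSign (!x) = -clickSign x := by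
  cases x <;> simp [clickSign]

lemma clickSign_sq (x : Bool) : clickSign x ^ 2 = 1 := by
  cases x <;> simp [clickSign]

namespace Realization

variable {k T : ℕ}

lemma flip_self (ρ : Realization k T) (i : Fin k) (t : Fin T) : ρ.flip i t i t = !ρ i t := by
  simp [Realization.flip]

lemma flip_of_agent_ne (ρ : Realization k T) {i j : Fin k} (h : j ≠ i) (t : Fin T) :
    ρ.flip i t j = ρ j := by
  simp [Realization.flip, h]

lemma flip_of_round_ne (ρ : Realization k T) (i j : Fin k) {s t : Fin T} (h : s ≠ t) :
    ρ.flip i t j s = ρ j s := by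
  obtain rfl | hj := eq_or_ne j i
  · simp [Realization.flip, h]
  · rw [flip_of_agent_ne ρ hj]

lemma flip_involutive (i : Fin k) (t : Fin T) :
    Function.Involutive fun ρ : Realization k T => ρ.flip i t := by
  intro ρ
  simp [Realization.flip]

/-- The probability of `ρ` when all bits are independent and those of agent `i` have mean `μ i`;
these are the weights of `clickExpectation`. -/
noncomputable def prob (μ : Fin k → Set.Icc (0 : ℝ) 1) (ρ : Realization k T) : ℝ :=
  ∏ i, ∏ t, if ρ i t then (μ i : ℝ) else 1 - (μ i : ℝ)

lemma prob_nonneg (μ : Fin k → Set.Icc (0 : ℝ) 1) (ρ : Realization k T) : 0 ≤ ρ.prob μ := by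
  refine Finset.prod_nonneg fun i _ => Finset.prod_nonneg fun t _ => ?_
  split_ifs
  · exact (μ i).2.1
  · exact sub_nonneg.2 (μ i).2.2

lemma sum_prob (μ : Fin k → Set.Icc (0 : ℝ) 1) : ∑ ρ : Realization k T, ρ.prob μ = 1 := by
  have hagent (i : Fin k) :
      ∑ r : Fin T → Bool, ∏ t, (if r t then (μ i : ℝ) else 1 - (μ i : ℝ)) = 1 := by
    rw [← Fintype.piFinset_univ,
      Finset.sum_prod_piFinset _ fun _ (x : Bool) => if x then (μ i : ℝ) else 1 - (μ i : ℝ)]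
    simp
  simp only [prob]
  rw [← Fintype.piFinset_univ,
    Finset.sum_prod_piFinset _ fun i (r : Fin T → Bool) =>
      ∏ t, if r t then (μ i : ℝ) else 1 - (μ i : ℝ)]
  simp [hagent]

lemma prob_flip {μ : Fin k → Set.Icc (0 : ℝ) 1} {i : Fin k} (hμ : (μ i : ℝ) = 1 / 2)
    (ρ : Realization k T) (t : Fin T) : (ρ.flip i t).prob μ = ρ.prob μ := by
  refine Finset.prod_congr rfl fun j _ => ?_
  obtain rfl | hj := eq_or_ne j i
  · norm_num [hμ]
  · rw [flip_of_agent_ne ρ hj]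

lemma prob_eq_prod_one_add_clickSign_mul_prob {μ ν : Fin k → Set.Icc (0 : ℝ) 1} {i : Fin k}
    {ε : ℝ} (hμ : (μ i : ℝ) = 1 / 2) (hν : (ν i : ℝ) = 1 / 2 + ε) (h : ∀ j ≠ i, ν j = μ j)
    (ρ : Realization k T) :
    ρ.prob ν = (∏ t, (1 + 2 * ε * clickSign (ρ i t))) * ρ.prob μ := by
  rw [prob, prob, ← Finset.mul_prod_erase _ _ (Finset.mem_univ i),
    ← Finset.mul_prod_erase _ _ (Finset.mem_univ i), ← mul_assoc, ← Finset.prod_mul_distrib]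
  congr 1
  · refine Finset.prod_congr rfl fun t _ => ?_
    cases ρ i t <;> norm_num [clickSign, hμ, hν] <;> ring
  · refine Finset.prod_congr rfl fun j hj => ?_
    rw [h j (Finset.ne_of_mem_erase hj)]

end Realization

section Expectation

variable {k T : ℕ} (μ : Fin k → Set.Icc (0 : ℝ) 1)

lemma clickExpectation_eq_sum_prob_mul (f : Realization k T → ℝ) :
    clickExpectation μ f = ∑ ρ : Realization k T, ρ.prob μ * f ρ := rfl

lemma clickExpectation_const (c : ℝ) : clickExpectation μ (fun _ : Realization k T => c) = c := by
  rw [clickExpectation_eq_sum_prob_mul, ← Finset.sum_mul, Realization.sum_prob, one_mul]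

lemma clickExpectation_add (f g : Realization k T → ℝ) :
    clickExpectation μ (fun ρ => f ρ + g ρ) = clickExpectation μ f + clickExpectation μ g := by
  simp only [clickExpectation, mul_add, Finset.sum_add_distrib]

lemma clickExpectation_sub (f g : Realization k T → ℝ) :
    clickExpectation μ (fun ρ => f ρ - g ρ) = clickExpectation μ f - clickExpectation μ g := by
  simp only [clickExpectation, mul_sub, Finset.sum_sub_distrib]

lemma clickExpectation_const_mul (c : ℝ) (f : Realization k T → ℝ) :
    clickExpectation μ (fun ρ => c * f ρ) = c * clickExpectation μ f := by
  simp only [clickExpectation, Finset.mul_sum, mul_left_comm c]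

lemma clickExpectation_sum {ι : Type*} (s : Finset ι) (f : ι → Realization k T → ℝ) :
    clickExpectation μ (fun ρ => ∑ j ∈ s, f j ρ) = ∑ j ∈ s, clickExpectation μ (f j) := by
  simp only [clickExpectation, Finset.mul_sum]
  exact Finset.sum_comm

lemma clickExpectation_mono {f g : Realization k T → ℝ} (h : ∀ ρ, f ρ ≤ g ρ) :
    clickExpectation μ f ≤ clickExpectation μ g :=
  Finset.sum_le_sum fun ρ _ => mul_le_mul_of_nonneg_left (h ρ) (ρ.prob_nonneg μ)

lemma clickExpectation_nonneg {f : Realization k T → ℝ} (h : ∀ ρ, 0 ≤ f ρ) :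
    0 ≤ clickExpectation μ f :=
  Finset.sum_nonneg fun ρ _ => mul_nonneg (ρ.prob_nonneg μ) (h ρ)

variable {μ}

lemma clickExpectation_comp_flip {i : Fin k} (hμ : (μ i : ℝ) = 1 / 2) (t : Fin T)
    (f : Realization k T → ℝ) :
    clickExpectation μ (fun ρ => f (ρ.flip i t)) = clickExpectation μ f := by
  rw [clickExpectation_eq_sum_prob_mul, clickExpectation_eq_sum_prob_mul,
    ← Equiv.sum_comp (Realization.flip_involutive i t).toPerm fun ρ => ρ.prob μ * f ρ]
  simp only [Function.Involutive.coe_toPerm, Realization.prob_flip hμ]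

lemma clickExpectation_eq_zero_of_flip_neg {i : Fin k} (hμ : (μ i : ℝ) = 1 / 2) (t : Fin T)
    {f : Realization k T → ℝ} (h : ∀ ρ, f (ρ.flip i t) = -f ρ) : clickExpectation μ f = 0 := by
  have hneg : clickExpectation μ f = -1 * clickExpectation μ f := by
    rw [← clickExpectation_const_mul, ← clickExpectation_comp_flip hμ t f]
    simp only [h, neg_one_mul]
  linarith

lemma clickExpectation_change_of_rate {ν : Fin k → Set.Icc (0 : ℝ) 1} {i : Fin k} {ε : ℝ}
    (hμ : (μ i : ℝ) = 1 / 2) (hν : (ν i : ℝ) = 1 / 2 + ε) (h : ∀ j ≠ i, ν j = μ j)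
    (f : Realization k T → ℝ) :
    clickExpectation ν f =
      clickExpectation μ fun ρ => (∏ t, (1 + 2 * ε * clickSign (ρ i t))) * f ρ := by
  simp only [clickExpectation_eq_sum_prob_mul,
    Realization.prob_eq_prod_one_add_clickSign_mul_prob hμ hν h]
  exact Finset.sum_congr rfl fun ρ _ => by ring

end Expectation

lemma exp_sub_two_mul_sq_le_one_add {y : ℝ} (hy : -(1 / 2) ≤ y) :
    Real.exp (y - 2 * y ^ 2) ≤ 1 + y := by
  have hpos : 0 < 1 + y := by linarith
  rw [← Real.le_log_iff_exp_le hpos]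
  calc y - 2 * y ^ 2 ≤ y / (1 + y) := by
        rw [le_div_iff₀ hpos]
        nlinarith only [mul_nonneg (sq_nonneg y) (by linarith : 0 ≤ 1 + 2 * y)]
    _ = 1 - (1 + y)⁻¹ := by field_simp; ring
    _ ≤ Real.log (1 + y) := Real.one_sub_inv_le_log_of_pos hpos

lemma one_add_sum_sub_two_mul_sum_sq_le_prod {ι : Type*} (s : Finset ι) (y : ι → ℝ)
    (hy : ∀ j ∈ s, -(1 / 2) ≤ y j) :
    1 + ∑ j ∈ s, y j - 2 * ∑ j ∈ s, y j ^ 2 ≤ ∏ j ∈ s, (1 + y j) := by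
  calc 1 + ∑ j ∈ s, y j - 2 * ∑ j ∈ s, y j ^ 2
      = ∑ j ∈ s, (y j - 2 * y j ^ 2) + 1 := by
        rw [Finset.sum_sub_distrib, Finset.mul_sum]; ring
    _ ≤ Real.exp (∑ j ∈ s, (y j - 2 * y j ^ 2)) := Real.add_one_le_exp _
    _ = ∏ j ∈ s, Real.exp (y j - 2 * y j ^ 2) := Real.exp_sum _ _
    _ ≤ ∏ j ∈ s, (1 + y j) :=
        Finset.prod_le_prod (fun _ _ => (Real.exp_pos _).le)
          fun j hj => exp_sub_two_mul_sq_le_one_add (hy j hj)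

namespace AllocationRule

variable {k T : ℕ}

/-- Agent `i` is shown in round `t` whatever the bids. For an exploration-separated rule these are
the only rounds in which the click bits of agent `i` can influence the allocation. -/
def Explores (A : AllocationRule k T) (i : Fin k) (ρ : Realization k T) (t : Fin T) : Prop :=
  ∀ b, A.alloc b ρ t = i

open scoped Classical in
/-- The centred click bit of agent `i` in round `t` if that round explores `i`, and `0` otherwise.
The partial sums over `t` form a martingale when agent `i` has click-through rate `1 / 2`. -/
noncomputable def exploredSign (A : AllocationRule k T) (i : Fin k) (ρ : Realization k T)
    (t : Fin T) : ℝ :=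
  if A.Explores i ρ t then clickSign (ρ i t) else 0

open scoped Classical in
/-- The number of rounds that explore agent `i`. -/
noncomputable def explorationCount (A : AllocationRule k T) (i : Fin k) (ρ : Realization k T) :
    ℕ :=
  Finset.card {t | A.Explores i ρ t}

/-- The number of rounds in which agent `i` is not shown. -/
def missedCount (A : AllocationRule k T) (b : Profile k) (i : Fin k) (ρ : Realization k T) : ℕ :=
  Finset.card {t | A.alloc b ρ t ≠ i}

/-- A function of the realization that does not depend on the click bits of agent `i` in rounds
that do not explore `i`. -/
def IgnoresUnexplored {β : Type*} (A : AllocationRule k T) (i : Fin k)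
    (f : Realization k T → β) : Prop :=
  ∀ ρ t, ¬A.Explores i ρ t → f (ρ.flip i t) = f ρ

variable (A : AllocationRule k T)

lemma alloc_flip_of_le (b : Profile k) (ρ : Realization k T) (i : Fin k) {s t : Fin T}
    (h : s ≤ t) : A.alloc b (ρ.flip i t) s = A.alloc b ρ s :=
  (A.online b ρ _ s fun _ hr => (ρ.flip_of_round_ne i _ (hr.trans_le h).ne).symm).symm

lemma alloc_flip_of_ne {b : Profile k} {ρ : Realization k T} {i : Fin k} {t : Fin T}
    (h : A.alloc b ρ t ≠ i) (s : Fin T) : A.alloc b (ρ.flip i t) s = A.alloc b ρ s := by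
  refine (A.online b ρ _ s fun r _ => ?_).symm
  obtain rfl | hr := eq_or_ne r t
  · rw [ρ.flip_of_agent_ne h]
  · rw [ρ.flip_of_round_ne i _ hr]

lemma explores_flip_iff_of_le (ρ : Realization k T) (i j : Fin k) {s t : Fin T} (h : s ≤ t) :
    A.Explores j (ρ.flip i t) s ↔ A.Explores j ρ s := by
  simp only [Explores, A.alloc_flip_of_le _ ρ i h]

lemma exploredSign_of_explores {ρ : Realization k T} {i : Fin k} {t : Fin T}
    (h : A.Explores i ρ t) : A.exploredSign i ρ t = clickSign (ρ i t) :=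
  if_pos h

lemma exploredSign_of_not_explores {ρ : Realization k T} {i : Fin k} {t : Fin T}
    (h : ¬A.Explores i ρ t) : A.exploredSign i ρ t = 0 :=
  if_neg h

lemma exploredSign_flip_self (ρ : Realization k T) (i : Fin k) (t : Fin T) :
    A.exploredSign i (ρ.flip i t) t = -A.exploredSign i ρ t := by
  have hiff := A.explores_flip_iff_of_le ρ i i (le_refl t)
  by_cases h : A.Explores i ρ t
  · rw [A.exploredSign_of_explores (hiff.2 h), A.exploredSign_of_explores h, ρ.flip_self,
      clickSign_not]
  · rw [A.exploredSign_of_not_explores (mt hiff.1 h), A.exploredSign_of_not_explores h, neg_zero]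

lemma exploredSign_flip_of_lt (ρ : Realization k T) (i : Fin k) {s t : Fin T} (h : s < t) :
    A.exploredSign i (ρ.flip i t) s = A.exploredSign i ρ s := by
  classical
  exact if_congr (A.explores_flip_iff_of_le ρ i i h.le) (by rw [ρ.flip_of_round_ne i i h.ne]) rfl

lemma abs_exploredSign_le_one (ρ : Realization k T) (i : Fin k) (t : Fin T) :
    |A.exploredSign i ρ t| ≤ 1 := by
  rw [← sq_le_one_iff_abs_le_one, exploredSign]
  split_ifs <;> simp [clickSign_sq]

lemma sum_exploredSign_sq (ρ : Realization k T) (i : Fin k) :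
    ∑ t, A.exploredSign i ρ t ^ 2 = A.explorationCount i ρ := by
  classical
  simp only [exploredSign, explorationCount, ite_pow, clickSign_sq, Finset.natCast_card_filter]
  simp

/-- The summands are martingale differences, hence orthogonal. -/
lemma clickExpectation_sum_exploredSign_sq {μ : Fin k → Set.Icc (0 : ℝ) 1} {i : Fin k}
    (hμ : (μ i : ℝ) = 1 / 2) :
    clickExpectation μ (fun ρ : Realization k T => (∑ t, A.exploredSign i ρ t) ^ 2) =
      clickExpectation μ fun ρ : Realization k T => (A.explorationCount i ρ : ℝ) := by
  have horth {s t : Fin T} (hst : s < t) : clickExpectation μ (fun ρ : Realization k T =>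
      A.exploredSign i ρ s * A.exploredSign i ρ t) = 0 := by
    refine clickExpectation_eq_zero_of_flip_neg hμ t fun ρ => ?_
    rw [A.exploredSign_flip_of_lt ρ i hst, A.exploredSign_flip_self, mul_neg]
  simp only [← sum_exploredSign_sq, pow_two, Finset.sum_mul_sum, clickExpectation_sum]
  refine Finset.sum_congr rfl fun s _ => Finset.sum_eq_single s (fun t _ hts => ?_) (by simp)
  rcases lt_or_gt_of_ne hts with hlt | hgt
  · simpa only [mul_comm] using horth hlt
  · exact horth hgt

/-- If round `t` does not explore `i`, the factor of that round averages to `1` over the two values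
of `ρ i t`. -/
lemma clickExpectation_one_add_clickSign_mul {μ : Fin k → Set.Icc (0 : ℝ) 1} {i : Fin k}
    (hμ : (μ i : ℝ) = 1 / 2) (c : ℝ) (t : Fin T) {f : Realization k T → ℝ}
    (hf : ∀ ρ, ¬A.Explores i ρ t → f (ρ.flip i t) = f ρ) :
    clickExpectation μ (fun ρ => (1 + c * clickSign (ρ i t)) * f ρ) =
      clickExpectation μ fun ρ => (1 + c * A.exploredSign i ρ t) * f ρ := by
  rw [← sub_eq_zero, ← clickExpectation_sub]
  refine clickExpectation_eq_zero_of_flip_neg hμ t fun ρ => ?_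
  rw [A.exploredSign_flip_self, ρ.flip_self, clickSign_not]
  by_cases h : A.Explores i ρ t
  · rw [A.exploredSign_of_explores h]
    ring
  · rw [A.exploredSign_of_not_explores h, hf ρ h]
    ring

namespace ExplorationSeparated

variable {A} (hA : A.ExplorationSeparated)
include hA

lemma ignoresUnexplored_alloc (i : Fin k) (b : Profile k) (s : Fin T) :
    A.IgnoresUnexplored i fun ρ => A.alloc b ρ s := by
  intro ρ t hnot
  by_contra hne
  have hi : A.alloc b ρ t = i := by
    by_contra hi
    exact hne (A.alloc_flip_of_ne hi s)
  have hlt : t < s := lt_of_not_ge fun hst => hne (A.alloc_flip_of_le b ρ i hst)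
  have hinf : A.Influential ρ t := ⟨b, s, hlt, by rw [hi]; exact Ne.symm hne⟩
  exact hnot fun b' => (hA ρ t hinf b' b).trans hi

lemma explores_flip_iff {ρ : Realization k T} {i : Fin k} {t : Fin T}
    (h : ¬A.Explores i ρ t) (s : Fin T) : A.Explores i (ρ.flip i t) s ↔ A.Explores i ρ s := by
  simp only [Explores, hA.ignoresUnexplored_alloc i _ s ρ t h]

lemma ignoresUnexplored_exploredSign (i : Fin k) (s : Fin T) :
    A.IgnoresUnexplored i fun ρ => A.exploredSign i ρ s := by
  intro ρ t h
  obtain rfl | hst := eq_or_ne s t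
  · simp only [A.exploredSign_flip_self, A.exploredSign_of_not_explores h, neg_zero]
  · classical
    exact if_congr (hA.explores_flip_iff h s) (by rw [ρ.flip_of_round_ne i i hst]) rfl

lemma ignoresUnexplored_missedCount (i j : Fin k) (b : Profile k) :
    A.IgnoresUnexplored i fun ρ => A.missedCount b j ρ := by
  intro ρ t h
  simp only [missedCount, hA.ignoresUnexplored_alloc i b _ ρ t h]

lemma clickExpectation_prod_one_add_clickSign_mul {μ : Fin k → Set.Icc (0 : ℝ) 1} {i : Fin k}
    (hμ : (μ i : ℝ) = 1 / 2) (c : ℝ) (s : Finset (Fin T)) {f : Realization k T → ℝ}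
    (hf : A.IgnoresUnexplored i f) :
    clickExpectation μ (fun ρ => (∏ t ∈ s, (1 + c * clickSign (ρ i t))) * f ρ) =
      clickExpectation μ fun ρ => (∏ t ∈ s, (1 + c * A.exploredSign i ρ t)) * f ρ := by
  induction s using Finset.induction_on generalizing f with
  | empty => simp
  | insert t s ht ih =>
    have hs (ρ : Realization k T) :
        ∏ r ∈ s, (1 + c * clickSign (ρ.flip i t i r)) = ∏ r ∈ s, (1 + c * clickSign (ρ i r)) :=
      Finset.prod_congr rfl fun r hr => by
        rw [ρ.flip_of_round_ne i i (ne_of_mem_of_not_mem hr ht)]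
    have hf' : A.IgnoresUnexplored i fun ρ => (1 + c * A.exploredSign i ρ t) * f ρ :=
      fun ρ r h => by simp only [hA.ignoresUnexplored_exploredSign i t ρ r h, hf ρ r h]
    simp only [Finset.prod_insert ht, mul_assoc]
    rw [A.clickExpectation_one_add_clickSign_mul hμ c t fun ρ h => by rw [hs, hf ρ t h]]
    simpa only [mul_left_comm] using ih hf'

end ExplorationSeparated

lemma one_sub_le_prod_one_add_exploredSign {ε : ℝ} (hε : |ε| ≤ 1 / 4) (i : Fin k)
    (ρ : Realization k T) :
    1 - (1 / 8 + 8 * ε ^ 2 * (∑ t, A.exploredSign i ρ t) ^ 2 +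
      8 * ε ^ 2 * A.explorationCount i ρ) ≤ ∏ t, (1 + 2 * ε * A.exploredSign i ρ t) := by
  have hsmall (t : Fin T) : |2 * ε * A.exploredSign i ρ t| ≤ 1 / 2 := by
    rw [abs_mul, abs_mul, abs_two]
    nlinarith [A.abs_exploredSign_le_one ρ i t, abs_nonneg (A.exploredSign i ρ t), abs_nonneg ε]
  have hprod := one_add_sum_sub_two_mul_sum_sq_le_prod Finset.univ
    (fun t => 2 * ε * A.exploredSign i ρ t) fun t _ => (abs_le.1 (hsmall t)).1
  simp only [mul_pow, ← Finset.mul_sum, sum_exploredSign_sq] at hprod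
  have hamgm : -(1 / 8 + 8 * ε ^ 2 * (∑ t, A.exploredSign i ρ t) ^ 2) ≤
      2 * ε * ∑ t, A.exploredSign i ρ t := by
    nlinarith [sq_nonneg (8 * ε * ∑ t, A.exploredSign i ρ t + 1)]
  linarith

/-- Few rounds exploring agent `i` do not suffice to notice that her click-through rate has moved
from `1 / 2` to `1 / 2 + ε`. -/
lemma ExplorationSeparated.le_clickExpectation_change_of_rate {A : AllocationRule k T}
    (hA : A.ExplorationSeparated) {μ ν : Fin k → Set.Icc (0 : ℝ) 1} {i : Fin k} {ε M : ℝ}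
    (hε : |ε| ≤ 1 / 4) (hμ : (μ i : ℝ) = 1 / 2) (hν : (ν i : ℝ) = 1 / 2 + ε)
    (hne : ∀ j ≠ i, ν j = μ j) {f : Realization k T → ℝ} (hf : A.IgnoresUnexplored i f)
    (hf0 : ∀ ρ, 0 ≤ f ρ) (hfM : ∀ ρ, f ρ ≤ M) :
    clickExpectation μ f - M * (1 / 8 + 16 * ε ^ 2 *
        clickExpectation μ fun ρ : Realization k T => (A.explorationCount i ρ : ℝ)) ≤
      clickExpectation ν f := by
  let loss (ρ : Realization k T) : ℝ :=
    1 / 8 + 8 * ε ^ 2 * (∑ t, A.exploredSign i ρ t) ^ 2 + 8 * ε ^ 2 * A.explorationCount i ρ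
  have hloss : clickExpectation μ loss = 1 / 8 + 16 * ε ^ 2 *
      clickExpectation μ fun ρ : Realization k T => (A.explorationCount i ρ : ℝ) := by
    simp only [loss, clickExpectation_add, clickExpectation_const, clickExpectation_const_mul,
      A.clickExpectation_sum_exploredSign_sq hμ]
    ring
  have hpointwise (ρ : Realization k T) :
      f ρ - M * loss ρ ≤ (∏ t, (1 + 2 * ε * A.exploredSign i ρ t)) * f ρ := by
    have hratio : (1 - loss ρ) * f ρ ≤ _ := mul_le_mul_of_nonneg_right
      (A.one_sub_le_prod_one_add_exploredSign hε i ρ) (hf0 ρ)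
    have hbound : f ρ * loss ρ ≤ M * loss ρ :=
      mul_le_mul_of_nonneg_right (hfM ρ) (by positivity)
    linarith
  rw [clickExpectation_change_of_rate hμ hν hne,
    hA.clickExpectation_prod_one_add_clickSign_mul hμ _ _ hf, ← hloss,
    ← clickExpectation_const_mul, ← clickExpectation_sub]
  exact clickExpectation_mono μ hpointwise

lemma missedCount_le (b : Profile k) (i : Fin k) (ρ : Realization k T) :
    A.missedCount b i ρ ≤ T :=
  (Finset.card_le_univ _).trans_eq (Fintype.card_fin T)

lemma sum_missedCount_eq_sum_card (b : Fin k → Profile k) (ρ : Realization k T) :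
    ∑ i, A.missedCount (b i) i ρ = ∑ t, Finset.card {i | A.alloc (b i) ρ t ≠ i} :=
  Finset.sum_card_bipartiteAbove_eq_sum_card_bipartiteBelow _

lemma sum_missedCount (b : Profile k) (ρ : Realization k T) :
    ∑ i, A.missedCount b i ρ = (k - 1) * T := by
  rw [A.sum_missedCount_eq_sum_card fun _ => b]
  simp [Finset.filter_ne, mul_comm]

/-- An exploring round shows the same agent for all bids, so it misses all the others even if each
of them is judged with a bid profile of her own. -/
lemma mul_sum_explorationCount_le_sum_missedCount (b : Fin k → Profile k)
    (ρ : Realization k T) :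
    (k - 1) * ∑ i, A.explorationCount i ρ ≤ ∑ i, A.missedCount (b i) i ρ := by
  classical
  have hswap : ∑ i, A.explorationCount i ρ = ∑ t, Finset.card {i | A.Explores i ρ t} :=
    Finset.sum_card_bipartiteAbove_eq_sum_card_bipartiteBelow fun i t => A.Explores i ρ t
  rw [hswap, A.sum_missedCount_eq_sum_card, Finset.mul_sum]
  refine Finset.sum_le_sum fun t _ => ?_
  by_cases h : ∃ j, A.Explores j ρ t
  · obtain ⟨j, hj⟩ := h
    have hone : Finset.card {i | A.Explores i ρ t} ≤ 1 :=
      Finset.card_le_one.2 fun i hi i' hi' => by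
        simp only [Finset.mem_filter_univ] at hi hi'
        rw [← hi (b j), hi' (b j)]
    have hmissed : Finset.card {i | A.alloc (b i) ρ t ≠ i} = k - 1 := by
      simp [hj _, Finset.filter_ne]
    rw [hmissed]
    exact mul_le_of_le_one_right' hone
  · have hnone : Finset.card {i | A.Explores i ρ t} = 0 :=
      Finset.card_eq_zero.2 (Finset.filter_eq_empty_iff.2 fun i _ hi => h ⟨i, hi⟩)
    rw [hnone, mul_zero]
    exact Nat.zero_le _

end AllocationRule

lemma StochasticInstance.payoff_le_iSup_payoff {k : ℕ} (I : StochasticInstance k) (i : Fin k) :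
    I.payoff i ≤ ⨆ j, I.payoff j :=
  le_ciSup (Set.finite_range I.payoff).bddAbove i

namespace AllocationRule

variable {k T : ℕ} (A : AllocationRule k T)

lemma regret_eq_clickExpectation_sum (I : StochasticInstance k) :
    A.regret I = clickExpectation I.ctr fun ρ : Realization k T =>
      ∑ t, ((⨆ i, I.payoff i) - I.payoff (A.alloc I.value ρ t)) := by
  simp [Finset.sum_sub_distrib, clickExpectation_sub, clickExpectation_const, regret]

lemma mul_clickExpectation_missedCount_le_regret (I : StochasticInstance k) (i : Fin k) {c : ℝ}
    (hc : ∀ j ≠ i, c ≤ I.payoff i - I.payoff j) :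
    c * clickExpectation I.ctr (fun ρ : Realization k T => (A.missedCount I.value i ρ : ℝ)) ≤
      A.regret I := by
  rw [regret_eq_clickExpectation_sum, ← clickExpectation_const_mul]
  refine clickExpectation_mono _ fun ρ => ?_
  rw [missedCount, Finset.natCast_card_filter, Finset.mul_sum]
  refine Finset.sum_le_sum fun t _ => ?_
  split_ifs with h
  · linarith [hc _ h, I.payoff_le_iSup_payoff i]
  · linarith [I.payoff_le_iSup_payoff (A.alloc I.value ρ t)]

end AllocationRule

/-- The click-through rate `1 / 2`. -/
noncomputable def halfRate : Set.Icc (0 : ℝ) 1 := ⟨1 / 2, by norm_num, by norm_num⟩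

lemma coe_halfRate : (halfRate : ℝ) = 1 / 2 := rfl

namespace StochasticInstance

variable {k : ℕ}

/-- All values are `v`, and all click-through rates are `1 / 2` except that of agent `i`. -/
noncomputable def rateFavoured (v : {x : ℝ // 0 < x}) (p : Set.Icc (0 : ℝ) 1) (i : Fin k) :
    StochasticInstance k where
  value := fun _ => v
  ctr := Function.update (fun _ => halfRate) i p

/-- All click-through rates are `1 / 2`, and all values are `w` except that of agent `i`, which
is `v`. -/
noncomputable def valueFavoured (v w : {x : ℝ // 0 < x}) (i : Fin k) : StochasticInstance k where
  value := Function.update (fun _ => w) i v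
  ctr := fun _ => halfRate

lemma payoff_rateFavoured_self (v : {x : ℝ // 0 < x}) (p : Set.Icc (0 : ℝ) 1) (i : Fin k) :
    (rateFavoured v p i).payoff i = p * v := by
  simp [payoff, rateFavoured]

lemma payoff_rateFavoured_of_ne (v : {x : ℝ // 0 < x}) (p : Set.Icc (0 : ℝ) 1) {i j : Fin k}
    (h : j ≠ i) : (rateFavoured v p i).payoff j = 1 / 2 * v := by
  simp [payoff, rateFavoured, coe_halfRate, h]

lemma payoff_valueFavoured_self (v w : {x : ℝ // 0 < x}) (i : Fin k) :
    (valueFavoured v w i).payoff i = 1 / 2 * v := by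
  simp [payoff, valueFavoured, coe_halfRate]

lemma payoff_valueFavoured_of_ne (v w : {x : ℝ // 0 < x}) {i j : Fin k} (h : j ≠ i) :
    (valueFavoured v w i).payoff j = 1 / 2 * w := by
  simp [payoff, valueFavoured, coe_halfRate, h]

lemma rateFavoured_mem_boundedInstances (v : {x : ℝ // 0 < x}) (p : Set.Icc (0 : ℝ) 1)
    (i : Fin k) : rateFavoured v p i ∈ boundedInstances k v :=
  fun _ => le_rfl

lemma valueFavoured_mem_gapInstances (hk : 2 ≤ k) {v w : {x : ℝ // 0 < x}} {δ : ℝ} (hδ : 0 ≤ δ)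
    (hw : (w : ℝ) = (1 - 2 * δ) * v) (i : Fin k) : valueFavoured v w i ∈ gapInstances k δ v := by
  have hwv : (w : ℝ) ≤ v := by
    rw [hw]
    nlinarith only [v.2, hδ]
  have hself : (valueFavoured v w i).value i = v := by simp [valueFavoured]
  have hvalue (j : Fin k) : ((valueFavoured v w i).value j : ℝ) ≤ v := by
    obtain rfl | hj := eq_or_ne j i
    · rw [hself]
    · simpa [valueFavoured, hj] using hwv
  have hsup : ⨆ j, ((valueFavoured v w i).value j : ℝ) = v :=
    have : Nonempty (Fin k) := ⟨i⟩
    le_antisymm (ciSup_le hvalue)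
      ((congrArg Subtype.val hself).ge.trans (le_ciSup
        (f := fun j => ((valueFavoured v w i).value j : ℝ)) (Set.finite_range _).bddAbove i))
  have : Nontrivial (Fin k) := Fin.nontrivial_iff_two_le.2 hk
  obtain ⟨j, hj⟩ := exists_ne i
  refine ⟨hvalue, i, j, hj.symm, fun l => ?_, fun l hl => ?_, ?_⟩
  · obtain rfl | hl := eq_or_ne l i
    · exact le_rfl
    · rw [payoff_valueFavoured_self, payoff_valueFavoured_of_ne v w hl]
      linarith
  · rw [payoff_valueFavoured_of_ne v w hl, payoff_valueFavoured_of_ne v w hj]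
  · rw [hsup, payoff_valueFavoured_self, payoff_valueFavoured_of_ne v w hj, hw]
    ring

end StochasticInstance

namespace AllocationRule

open StochasticInstance

variable {k T : ℕ}

/-- The expected number of rounds that explore agent `i` when all click-through rates are
`1 / 2`. -/
noncomputable def expectedExploration (A : AllocationRule k T) (i : Fin k) : ℝ :=
  clickExpectation (fun _ => halfRate) fun ρ : Realization k T => (A.explorationCount i ρ : ℝ)

lemma expectedExploration_nonneg (A : AllocationRule k T) (i : Fin k) :
    0 ≤ A.expectedExploration i :=
  clickExpectation_nonneg _ fun _ => Nat.cast_nonneg _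

namespace ExplorationSeparated

variable {A : AllocationRule k T}

lemma le_regret_rateFavoured (hA : A.ExplorationSeparated) (v : {x : ℝ // 0 < x})
    {p : Set.Icc (0 : ℝ) 1} {ε : ℝ} (hε : 0 ≤ ε) (hε' : ε ≤ 1 / 4) (hp : (p : ℝ) = 1 / 2 + ε)
    (i : Fin k) :
    ε * v * (clickExpectation (fun _ => halfRate)
        (fun ρ : Realization k T => (A.missedCount (fun _ => v) i ρ : ℝ)) -
      T * (1 / 8 + 16 * ε ^ 2 * A.expectedExploration i)) ≤
      A.regret (rateFavoured v p i) := by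
  have hgap (j : Fin k) (hj : j ≠ i) :
      ε * v ≤ (rateFavoured v p i).payoff i - (rateFavoured v p i).payoff j := by
    rw [payoff_rateFavoured_self, payoff_rateFavoured_of_ne v p hj, hp]
    exact le_of_eq (by ring)
  refine le_trans (mul_le_mul_of_nonneg_left ?_ (mul_nonneg hε v.2.le))
    (A.mul_clickExpectation_missedCount_le_regret _ i hgap)
  refine hA.le_clickExpectation_change_of_rate (abs_le.2 ⟨by linarith, hε'⟩) coe_halfRate
    ?_ (fun j hj => ?_) (fun ρ t h => ?_) (fun _ => Nat.cast_nonneg _)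
    fun ρ => Nat.cast_le.2 (A.missedCount_le _ i ρ)
  · simp [rateFavoured, hp]
  · simp [rateFavoured, hj]
  · exact congrArg Nat.cast (hA.ignoresUnexplored_missedCount i i _ ρ t h)

lemma le_sum_regret_rateFavoured (hA : A.ExplorationSeparated) (hk : 2 ≤ k)
    (v : {x : ℝ // 0 < x}) {p : Set.Icc (0 : ℝ) 1} {ε : ℝ} (hε : 0 ≤ ε) (hε' : ε ≤ 1 / 4)
    (hp : (p : ℝ) = 1 / 2 + ε) :
    ε * v * T * (3 / 8 * k - 16 * ε ^ 2 * ∑ i, A.expectedExploration i) ≤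
      ∑ i, A.regret (rateFavoured v p i) := by
  have hk' : (2 : ℝ) ≤ k := by exact_mod_cast hk
  have hmissed : ∑ i, clickExpectation (fun _ => halfRate)
      (fun ρ : Realization k T => (A.missedCount (fun _ => v) i ρ : ℝ)) = (k - 1) * T := by
    rw [← clickExpectation_sum]
    simp only [← Nat.cast_sum, sum_missedCount, clickExpectation_const]
    push_cast [Nat.cast_sub (one_le_two.trans hk)]
    ring
  calc ε * v * T * (3 / 8 * k - 16 * ε ^ 2 * ∑ i, A.expectedExploration i)
      ≤ ε * v * T * ((k - 1) - k * (1 / 8) - 16 * ε ^ 2 * ∑ i, A.expectedExploration i) := by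
        refine mul_le_mul_of_nonneg_left (by linarith) ?_
        exact mul_nonneg (mul_nonneg hε v.2.le) (Nat.cast_nonneg T)
    _ = ∑ i, ε * v * (clickExpectation (fun _ => halfRate)
          (fun ρ : Realization k T => (A.missedCount (fun _ => v) i ρ : ℝ)) -
        T * (1 / 8 + 16 * ε ^ 2 * A.expectedExploration i)) := by
        simp only [← Finset.mul_sum, Finset.sum_sub_distrib, Finset.sum_add_distrib, hmissed,
          Finset.sum_const, Finset.card_univ, Fintype.card_fin, nsmul_eq_mul]
        ring
    _ ≤ ∑ i, A.regret (rateFavoured v p i) :=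
        Finset.sum_le_sum fun i _ => hA.le_regret_rateFavoured v hε hε' hp i

end ExplorationSeparated

lemma mul_sum_expectedExploration_le_sum_regret_valueFavoured (A : AllocationRule k T)
    {v w : {x : ℝ // 0 < x}} {δ : ℝ} (hδ : 0 ≤ δ) (hw : (w : ℝ) = (1 - 2 * δ) * v) :
    δ * v * ((k - 1 : ℕ) * ∑ i, A.expectedExploration i) ≤
      ∑ i, A.regret (valueFavoured v w i) := by
  have hgap (i j : Fin k) (hj : j ≠ i) :
      δ * v ≤ (valueFavoured v w i).payoff i - (valueFavoured v w i).payoff j := by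
    rw [payoff_valueFavoured_self, payoff_valueFavoured_of_ne v w hj, hw]
    exact le_of_eq (by ring)
  calc δ * v * ((k - 1 : ℕ) * ∑ i, A.expectedExploration i)
      ≤ δ * v * ∑ i, clickExpectation (fun _ => halfRate)
          (fun ρ : Realization k T => (A.missedCount (valueFavoured v w i).value i ρ : ℝ)) := by
        refine mul_le_mul_of_nonneg_left ?_ (mul_nonneg hδ v.2.le)
        simp only [expectedExploration, ← clickExpectation_sum, ← clickExpectation_const_mul]
        refine clickExpectation_mono _ fun ρ => ?_
        exact_mod_cast A.mul_sum_explorationCount_le_sum_missedCount _ ρ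
    _ = ∑ i, δ * v * clickExpectation (fun _ => halfRate)
          (fun ρ : Realization k T => (A.missedCount (valueFavoured v w i).value i ρ : ℝ)) :=
        Finset.mul_sum _ _ _
    _ ≤ ∑ i, A.regret (valueFavoured v w i) :=
        Finset.sum_le_sum fun i _ =>
          A.mul_clickExpectation_missedCount_le_regret (valueFavoured v w i) i (hgap i)

lemma ExplorationSeparated.le_sum_regret_add_sum_regret {A : AllocationRule k T}
    (hA : A.ExplorationSeparated) (hk : 2 ≤ k) {v w : {x : ℝ // 0 < x}} {p : Set.Icc (0 : ℝ) 1}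
    {ε δ : ℝ} (hε : 0 ≤ ε) (hε' : ε ≤ 1 / 4) (hδ : 0 < δ) (hp : (p : ℝ) = 1 / 2 + ε)
    (hw : (w : ℝ) = (1 - 2 * δ) * v) :
    k * (3 / 8 * ε * T * v) ≤ ∑ i, A.regret (rateFavoured v p i) +
      32 * ε ^ 3 * T / (k * δ) * ∑ i, A.regret (valueFavoured v w i) := by
  have hv : 0 < (v : ℝ) := v.2
  have : (0 : ℝ) < k := by positivity
  have hhalf : (k : ℝ) / 2 ≤ (k - 1 : ℕ) := by
    have hk' : (2 : ℝ) ≤ k := by exact_mod_cast hk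
    push_cast [Nat.cast_sub (one_le_two.trans hk)]
    linarith
  have hexplore : 0 ≤ ∑ i, A.expectedExploration i :=
    Finset.sum_nonneg fun i _ => A.expectedExploration_nonneg i
  calc k * (3 / 8 * ε * T * v)
      = ε * v * T * (3 / 8 * k - 16 * ε ^ 2 * ∑ i, A.expectedExploration i) +
          32 * ε ^ 3 * T / (k * δ) * (δ * v * (k / 2 * ∑ i, A.expectedExploration i)) := by
        field_simp
        ring
    _ ≤ ε * v * T * (3 / 8 * k - 16 * ε ^ 2 * ∑ i, A.expectedExploration i) +
          32 * ε ^ 3 * T / (k * δ) * (δ * v * ((k - 1 : ℕ) * ∑ i, A.expectedExploration i)) := by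
        gcongr
    _ ≤ ∑ i, A.regret (rateFavoured v p i) +
          32 * ε ^ 3 * T / (k * δ) * ∑ i, A.regret (valueFavoured v w i) := by
        gcongr
        · exact hA.le_sum_regret_rateFavoured hk v hε hε' hp
        · exact A.mul_sum_expectedExploration_le_sum_regret_valueFavoured hδ.le hw

lemma measurable_alloc (b : Profile k) (ρ : Realization k T) (t : Fin T) :
    Measurable fun A : AllocationRule k T => A.alloc b ρ t :=
  measurable_iff_comap_le.2 (le_iSup_of_le b (le_iSup_of_le ρ (le_iSup_of_le t le_rfl)))

lemma measurable_regret (I : StochasticInstance k) :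
    Measurable fun A : AllocationRule k T => A.regret I := by
  have hpayoff (ρ : Realization k T) (t : Fin T) :
      Measurable fun A : AllocationRule k T => I.payoff (A.alloc I.value ρ t) :=
    (measurable_of_countable I.payoff).comp (measurable_alloc I.value ρ t)
  unfold regret clickExpectation
  fun_prop

end AllocationRule

section Distributions

open StochasticInstance

variable {k T : ℕ} (D : Measure (SeparatedRule k T))

lemma worstCaseExpectedRegret_le_expectedWorstCaseRegret (S : Set (StochasticInstance k)) :
    worstCaseExpectedRegret D S ≤ expectedWorstCaseRegret D S :=
  iSup₂_le fun I hI => lintegral_mono fun A =>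
    le_iSup₂ (f := fun I (_ : I ∈ S) => ENNReal.ofReal (A.1.regret I)) I hI

lemma worstCaseExpectedRegret_mono {S S' : Set (StochasticInstance k)} (h : S ⊆ S') :
    worstCaseExpectedRegret D S ≤ worstCaseExpectedRegret D S' :=
  biSup_mono h

lemma lintegral_regret_le_worstCaseExpectedRegret {S : Set (StochasticInstance k)}
    {I : StochasticInstance k} (hI : I ∈ S) :
    ∫⁻ A, ENNReal.ofReal (A.1.regret I) ∂D ≤ worstCaseExpectedRegret D S :=
  le_iSup₂ (f := fun I (_ : I ∈ S) => ∫⁻ A, ENNReal.ofReal (A.1.regret I) ∂D) I hI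

lemma measurable_ofReal_sum_regret {ι : Type*} (s : Finset ι) (I : ι → StochasticInstance k) :
    Measurable fun A : SeparatedRule k T => ENNReal.ofReal (∑ i ∈ s, A.1.regret (I i)) :=
  (Finset.measurable_sum s fun i _ =>
    (AllocationRule.measurable_regret (I i)).comp measurable_subtype_coe).ennreal_ofReal

lemma lintegral_sum_regret_le {ι : Type*} [Fintype ι] {S : Set (StochasticInstance k)}
    {I : ι → StochasticInstance k} (hI : ∀ i, I i ∈ S) :
    ∫⁻ A, ENNReal.ofReal (∑ i, A.1.regret (I i)) ∂D ≤
      Fintype.card ι * worstCaseExpectedRegret D S := by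
  calc ∫⁻ A, ENNReal.ofReal (∑ i, A.1.regret (I i)) ∂D
      ≤ ∫⁻ A, ∑ i, ENNReal.ofReal (A.1.regret (I i)) ∂D :=
        lintegral_mono fun A => Finset.le_sum_of_subadditive _ ENNReal.ofReal_zero.le
          (fun _ _ => ENNReal.ofReal_add_le) _ _
    _ = ∑ i, ∫⁻ A, ENNReal.ofReal (A.1.regret (I i)) ∂D :=
        lintegral_finsetSum _ fun i _ => by
          simpa using measurable_ofReal_sum_regret (T := T) {i} I
    _ ≤ ∑ _i : ι, worstCaseExpectedRegret D S :=
        Finset.sum_le_sum fun i _ => lintegral_regret_le_worstCaseExpectedRegret D (hI i)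
    _ = Fintype.card ι * worstCaseExpectedRegret D S := by simp

lemma le_worstCaseExpectedRegret_add [IsProbabilityMeasure D] (hk : 2 ≤ k) {v ε δ : ℝ}
    (hv : 0 < v) (hε : 0 ≤ ε) (hε' : ε ≤ 1 / 4) (hδ : 0 < δ) (hδ' : δ < 1 / 2) :
    ENNReal.ofReal (3 / 8 * ε * T * v) ≤ worstCaseExpectedRegret D (boundedInstances k v) +
      ENNReal.ofReal (32 * ε ^ 3 * T / (k * δ)) *
        worstCaseExpectedRegret D (gapInstances k δ v) := by
  let v' : {x : ℝ // 0 < x} := ⟨v, hv⟩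
  let w : {x : ℝ // 0 < x} := ⟨(1 - 2 * δ) * v, mul_pos (by linarith) hv⟩
  let p : Set.Icc (0 : ℝ) 1 := ⟨1 / 2 + ε, by linarith, by linarith⟩
  set c : ℝ := 32 * ε ^ 3 * T / (k * δ)
  have hc : 0 ≤ c := by positivity
  have hrate := lintegral_sum_regret_le D fun i : Fin k => rateFavoured_mem_boundedInstances v' p i
  have hvalue := lintegral_sum_regret_le D fun i : Fin k =>
    valueFavoured_mem_gapInstances hk (v := v') (w := w) hδ.le rfl i
  rw [Fintype.card_fin] at hrate hvalue
  have hk0 : (k : ℝ≥0∞) ≠ 0 := Nat.cast_ne_zero.2 (by lia)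
  rw [← ENNReal.mul_le_mul_iff_right hk0 (ENNReal.natCast_ne_top k)]
  calc (k : ℝ≥0∞) * ENNReal.ofReal (3 / 8 * ε * T * v)
      = ∫⁻ _A, ENNReal.ofReal (k * (3 / 8 * ε * T * v)) ∂D := by
        rw [lintegral_const, measure_univ, mul_one, ENNReal.ofReal_mul (Nat.cast_nonneg k),
          ENNReal.ofReal_natCast]
    _ ≤ ∫⁻ A, (ENNReal.ofReal (∑ i, A.1.regret (rateFavoured v' p i)) +
          ENNReal.ofReal c * ENNReal.ofReal (∑ i, A.1.regret (valueFavoured v' w i))) ∂D := by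
        refine lintegral_mono fun A => ?_
        rw [← ENNReal.ofReal_mul hc]
        exact (ENNReal.ofReal_le_ofReal
          (A.2.le_sum_regret_add_sum_regret hk hε hε' hδ rfl rfl)).trans ENNReal.ofReal_add_le
    _ = ∫⁻ A, ENNReal.ofReal (∑ i, A.1.regret (rateFavoured v' p i)) ∂D +
          ENNReal.ofReal c * ∫⁻ A, ENNReal.ofReal (∑ i, A.1.regret (valueFavoured v' w i)) ∂D := by
        rw [lintegral_add_left (measurable_ofReal_sum_regret _ _),
          lintegral_const_mul' _ _ ENNReal.ofReal_ne_top]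
    _ ≤ k * worstCaseExpectedRegret D (boundedInstances k v) +
          ENNReal.ofReal c * (k * worstCaseExpectedRegret D (gapInstances k δ v)) := by
        gcongr
    _ = k * (worstCaseExpectedRegret D (boundedInstances k v) +
          ENNReal.ofReal c * worstCaseExpectedRegret D (gapInstances k δ v)) := by
        ring

lemma ofReal_le_worstCaseExpectedRegret_boundedInstances [IsProbabilityMeasure D] (hk : 2 ≤ k)
    {v ε : ℝ} (hv : 0 < v) (hε : 0 ≤ ε) (hε' : ε ≤ 1 / 4) (hεk : 64 * ε ^ 3 * T ≤ k) :
    ENNReal.ofReal (1 / 8 * ε * T * v) ≤ worstCaseExpectedRegret D (boundedInstances k v) := by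
  have : (0 : ℝ) < k := by positivity
  have hcoeff : 32 * ε ^ 3 * T / (k * (1 / 4)) ≤ 2 := by
    rw [div_le_iff₀ (by positivity)]
    linarith
  have hgap : gapInstances k (1 / 4) v ⊆ boundedInstances k v := fun _ hI => hI.1
  rw [← ENNReal.mul_le_mul_iff_right (a := 3) (by simp) (by simp)]
  calc 3 * ENNReal.ofReal (1 / 8 * ε * T * v)
      = ENNReal.ofReal (3 / 8 * ε * T * v) := by
        rw [← ENNReal.ofReal_ofNat, ← ENNReal.ofReal_mul (by norm_num)]
        ring_nf
    _ ≤ worstCaseExpectedRegret D (boundedInstances k v) +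
          ENNReal.ofReal (32 * ε ^ 3 * T / (k * (1 / 4))) *
            worstCaseExpectedRegret D (gapInstances k (1 / 4) v) :=
        le_worstCaseExpectedRegret_add D hk hv hε hε' (by norm_num) (by norm_num)
    _ ≤ worstCaseExpectedRegret D (boundedInstances k v) +
          ENNReal.ofReal 2 * worstCaseExpectedRegret D (boundedInstances k v) := by
        gcongr
        exact worstCaseExpectedRegret_mono D hgap
    _ = 3 * worstCaseExpectedRegret D (boundedInstances k v) := by
        rw [ENNReal.ofReal_ofNat]
        ring

lemma ofReal_rpow_mul_rpow_le_worstCaseExpectedRegret [IsProbabilityMeasure D] (hk : 2 ≤ k)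
    (hkT : k ≤ T) {v : ℝ} (hv : 0 < v) :
    ENNReal.ofReal (1 / 32 * v * (k : ℝ) ^ (1 / 3 : ℝ) * (T : ℝ) ^ (2 / 3 : ℝ)) ≤
      worstCaseExpectedRegret D (boundedInstances k v) := by
  have hk0 : (0 : ℝ) < k := by positivity
  have hT0 : (0 : ℝ) < T := hk0.trans_le (by exact_mod_cast hkT)
  set x : ℝ := ((k : ℝ) / T) ^ (1 / 3 : ℝ) with hx
  have hx1 : x ≤ 1 := Real.rpow_le_one (by positivity)
    ((div_le_one hT0).2 (by exact_mod_cast hkT)) (by norm_num)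
  have hx3 : x ^ 3 = k / T := by
    rw [hx, ← Real.rpow_natCast, ← Real.rpow_mul (by positivity)]
    norm_num
  have hxT : x * T = (k : ℝ) ^ (1 / 3 : ℝ) * (T : ℝ) ^ (2 / 3 : ℝ) := by
    rw [hx, Real.div_rpow hk0.le hT0.le, div_mul_eq_mul_div, mul_div_assoc]
    congr 1
    rw [div_eq_iff (by positivity), ← Real.rpow_add hT0]
    norm_num
  calc ENNReal.ofReal (1 / 32 * v * (k : ℝ) ^ (1 / 3 : ℝ) * (T : ℝ) ^ (2 / 3 : ℝ))
      = ENNReal.ofReal (1 / 8 * (x / 4) * T * v) := by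
        rw [mul_assoc (1 / 32 * v), ← hxT]
        ring_nf
    _ ≤ worstCaseExpectedRegret D (boundedInstances k v) := by
        refine ofReal_le_worstCaseExpectedRegret_boundedInstances D hk hv (by positivity)
          (by linarith) (le_of_eq ?_)
        rw [div_pow, hx3]
        field_simp
        norm_num

lemma ofReal_le_worstCaseExpectedRegret_gapInstances [IsProbabilityMeasure D] (hk : 2 ≤ k)
    (hT : 1 ≤ T) {v ε δ : ℝ} (hv : 0 < v) (hε : 0 < ε) (hε' : ε ≤ 1 / 4) (hδ : 0 < δ)
    (hδ' : δ < 1 / 2)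
    (hD : worstCaseExpectedRegret D (boundedInstances k v) ≤
      ENNReal.ofReal (3 / 16 * ε * T * v)) :
    ENNReal.ofReal (3 * k / (512 * ε ^ 2) * δ * v) ≤
      worstCaseExpectedRegret D (gapInstances k δ v) := by
  have : (0 : ℝ) < T := by positivity
  have : (0 : ℝ) < k := by positivity
  obtain htop | hfinite := eq_or_ne (worstCaseExpectedRegret D (gapInstances k δ v)) ⊤
  · exact htop ▸ le_top
  have htrade := (le_worstCaseExpectedRegret_add D hk hv hε.le hε' hδ hδ').trans
    (add_le_add_left hD _)
  rw [← ENNReal.ofReal_toReal hfinite] at htrade ⊢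
  set W := (worstCaseExpectedRegret D (gapInstances k δ v)).toReal
  have : 0 ≤ W := ENNReal.toReal_nonneg
  set c : ℝ := 32 * ε ^ 3 * T / (k * δ) with hc
  have hc0 : 0 < c := by positivity
  rw [← ENNReal.ofReal_mul hc0.le, ← ENNReal.ofReal_add (by positivity) (by positivity),
    ENNReal.ofReal_le_ofReal_iff (by positivity)] at htrade
  refine ENNReal.ofReal_le_ofReal (le_of_mul_le_mul_left ?_ hc0)
  calc c * (3 * k / (512 * ε ^ 2) * δ * v) = 3 / 16 * ε * T * v := by
        rw [hc]
        field_simp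
        norm_num
    _ ≤ c * W := by linarith

lemma ofReal_rpow_le_worstCaseExpectedRegret_gapInstances [IsProbabilityMeasure D] (hk : 2 ≤ k)
    (hT : 1 ≤ T) {v γ lam a δ : ℝ} (hv : 0 < v) (ha : 0 < a)
    (haT : a * (T : ℝ) ^ (γ - 1) ≤ 1 / 4) (hlam : lam ≤ 2 * (1 - γ)) (hδ : 0 < δ)
    (hδ' : δ < 1 / 2)
    (hD : worstCaseExpectedRegret D (boundedInstances k v) ≤
      ENNReal.ofReal (3 / 16 * a * v * (T : ℝ) ^ γ)) :
    ENNReal.ofReal (3 / (256 * a ^ 2) * δ * v * (T : ℝ) ^ lam) ≤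
      worstCaseExpectedRegret D (gapInstances k δ v) := by
  have hk2 : (2 : ℝ) ≤ k := by exact_mod_cast hk
  have hT1 : (1 : ℝ) ≤ T := by exact_mod_cast hT
  have hT0 : (0 : ℝ) < T := by positivity
  set y : ℝ := (T : ℝ) ^ (γ - 1) with hy
  have hyT : y * T = (T : ℝ) ^ γ := by
    rw [hy, ← Real.rpow_add_one hT0.ne', sub_add_cancel]
  have hlam_le : (T : ℝ) ^ lam ≤ (y ^ 2)⁻¹ := by
    rw [hy, ← Real.rpow_natCast, ← Real.rpow_mul hT0.le, ← Real.rpow_neg hT0.le]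
    refine Real.rpow_le_rpow_of_exponent_le hT1 ?_
    push_cast
    linarith
  have hD' : worstCaseExpectedRegret D (boundedInstances k v) ≤
      ENNReal.ofReal (3 / 16 * (a * y) * T * v) := by
    refine hD.trans_eq (congrArg _ ?_)
    rw [← hyT]
    ring
  refine le_trans (ENNReal.ofReal_le_ofReal ?_)
    (ofReal_le_worstCaseExpectedRegret_gapInstances D hk hT hv (by positivity) haT hδ hδ' hD')
  calc 3 / (256 * a ^ 2) * δ * v * (T : ℝ) ^ lam
      ≤ 3 / (256 * a ^ 2) * δ * v * (y ^ 2)⁻¹ := by gcongr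
    _ = 3 * 2 / (512 * (a * y) ^ 2) * δ * v := by
        field_simp
        norm_num
    _ ≤ 3 * k / (512 * (a * y) ^ 2) * δ * v := by gcongr

end Distributions

lemma exists_forall_ge_mul_rpow_le {γ : ℝ} (hγ : γ < 1) (a : ℝ) {b : ℝ} (hb : 0 < b) :
    ∃ N : ℕ, ∀ n ≥ N, a * (n : ℝ) ^ (γ - 1) ≤ b := by
  have hlim : Filter.Tendsto (fun n : ℕ => a * (n : ℝ) ^ (γ - 1)) Filter.atTop (nhds 0) := by
    simpa using ((tendsto_rpow_neg_atTop (sub_pos.2 hγ)).comp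
      tendsto_natCast_atTop_atTop).const_mul a
  exact Filter.eventually_atTop.1 (hlim.eventually_le_const hb)

theorem mainTheorem7_general :
    (∃ c : ℝ, 0 < c ∧ ∀ (k T : ℕ), 2 ≤ k → k ≤ T → ∀ vmax : ℝ, 0 < vmax →
      ∀ D : Measure (SeparatedRule k T), IsProbabilityMeasure D →
        ENNReal.ofReal (c * vmax * (k : ℝ) ^ (1 / 3 : ℝ) * (T : ℝ) ^ (2 / 3 : ℝ)) ≤
            expectedWorstCaseRegret D (boundedInstances k vmax) ∧
        ENNReal.ofReal (c * vmax * (k : ℝ) ^ (1 / 3 : ℝ) * (T : ℝ) ^ (2 / 3 : ℝ)) ≤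
            worstCaseExpectedRegret D (boundedInstances k vmax)) ∧
    (∀ γ lam C : ℝ, γ < 1 → lam ≤ 2 * (1 - γ) →
      ∃ c : ℝ, 0 < c ∧ ∃ T₁ : ℕ, ∀ (k T : ℕ), 2 ≤ k → T₁ ≤ T → ∀ vmax : ℝ, 0 < vmax →
        ∀ D : Measure (SeparatedRule k T), IsProbabilityMeasure D →
          worstCaseExpectedRegret D (boundedInstances k vmax) ≤
            ENNReal.ofReal (C * vmax * (T : ℝ) ^ γ) →
          ∀ δ : ℝ, 0 < δ → δ < 1 / 2 →
            ENNReal.ofReal (c * δ * vmax * (T : ℝ) ^ lam) ≤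
                expectedWorstCaseRegret D (gapInstances k δ vmax) ∧
            ENNReal.ofReal (c * δ * vmax * (T : ℝ) ^ lam) ≤
                worstCaseExpectedRegret D (gapInstances k δ vmax)) := by
  refine ⟨⟨1 / 32, by norm_num, fun k T hk hkT v hv D _ => ?_⟩, fun γ lam C hγ hlam => ?_⟩
  · have h := ofReal_rpow_mul_rpow_le_worstCaseExpectedRegret D hk hkT hv
    exact ⟨h.trans (worstCaseExpectedRegret_le_expectedWorstCaseRegret D _), h⟩
  · set a : ℝ := 16 / 3 * max C 1 with ha
    have hC : C ≤ 3 / 16 * a := by linarith [le_max_left C 1]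
    have ha0 : 0 < a := by positivity
    obtain ⟨N, hN⟩ := exists_forall_ge_mul_rpow_le hγ a (b := 1 / 4) (by norm_num)
    refine ⟨3 / (256 * a ^ 2), by positivity, max N 1, fun k T hk hT v hv D _ hD δ hδ hδ' => ?_⟩
    have hD' := hD.trans (ENNReal.ofReal_le_ofReal
      (by gcongr : C * v * (T : ℝ) ^ γ ≤ 3 / 16 * a * v * (T : ℝ) ^ γ))
    have h := ofReal_rpow_le_worstCaseExpectedRegret_gapInstances D hk (le_of_max_le_right hT) hv
      ha0 (hN T (le_of_max_le_left hT)) hlam hδ hδ' hD'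
    exact ⟨h.trans (worstCaseExpectedRegret_le_expectedWorstCaseRegret D _), h⟩

theorem mainTheorem7 :
    (∃ c : ℝ, 0 < c ∧ ∀ (k T : ℕ), 2 ≤ k → k ≤ T → ∀ vmax : ℝ, 0 < vmax →
      ∀ D : Measure (SeparatedRule k T), IsProbabilityMeasure D →
        ENNReal.ofReal (c * vmax * (k : ℝ) ^ (1 / 3 : ℝ) * (T : ℝ) ^ (2 / 3 : ℝ)) ≤
            expectedWorstCaseRegret D (boundedInstances k vmax) ∧
        ENNReal.ofReal (c * vmax * (k : ℝ) ^ (1 / 3 : ℝ) * (T : ℝ) ^ (2 / 3 : ℝ)) ≤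
            worstCaseExpectedRegret D (boundedInstances k vmax)) ∧
    (∀ γ lam C : ℝ, γ < 1 → lam < 2 * (1 - γ) →
      ∃ c : ℝ, 0 < c ∧ ∃ T₁ : ℕ, ∀ (k T : ℕ), 2 ≤ k → T₁ ≤ T → ∀ vmax : ℝ, 0 < vmax →
        ∀ D : Measure (SeparatedRule k T), IsProbabilityMeasure D →
          worstCaseExpectedRegret D (boundedInstances k vmax) ≤
            ENNReal.ofReal (C * vmax * (T : ℝ) ^ γ) →
          ∀ δ : ℝ, 0 < δ → δ ≤ 1 / 4 →
            ENNReal.ofReal (c * δ * vmax * (T : ℝ) ^ lam) ≤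
                expectedWorstCaseRegret D (gapInstances k δ vmax) ∧
            ENNReal.ofReal (c * δ * vmax * (T : ℝ) ^ lam) ≤
                worstCaseExpectedRegret D (gapInstances k δ vmax)) := by
  refine mainTheorem7_general.imp_right fun h γ lam C hγ hlam => ?_
  obtain ⟨c, hc, T₁, hT₁⟩ := h γ lam C hγ hlam.le
  exact ⟨c, hc, T₁, fun k T hk hT v hv D hD hreg δ hδ hδ' =>
    hT₁ k T hk hT v hv D hD hreg δ hδ (by linarith)⟩
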